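/- Let $m, d \ge 0$ be integers with $m$ odd and $m \ge d$, let $S^m = \{p \in \mathbb{R}^{m+1} : \|p\| = 1\}$ be the Euclidean unit sphere, and let $f : S^m \to \mathbb{R}^d$ be a continuous odd map, that is, $f(-p) = -f(p)$ for all $p \in S^m$. Then there exist points $p_1, p_2 \in S^m$ with $p_1 \ne p_2$ and $p_1 \ne -p_2$ such that $f(p_1) = f(p_2)$. -/

import Mathlib

/-! ### Mod 2 cochains on finite sequences -/

/-! When `m` is odd, `m + 1` is even, so the sphere carries a map `J` commuting with negation with
`J ∘ J = -1`. The map `p ↦ f p - f (J p)` is odd, so Borsuk–Ulam gives it a zero `p`; since `p ≠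
-p`, the points `p` and `J p` are neither equal nor antipodal.

Borsuk–Ulam is proved mod 2, without triangulations. Starting from a point, the hemisphere chain
plus its antipodal image is a cycle, and coning that cycle in small prism steps gives the hemisphere
one dimension up (`IsHemisphereChain.exists_succ`). Cup products of coboundaries of antipodal sign
functions evaluate to 1 on these chains, so some arbitrarily fine list sees every coordinate of an
odd map change sign. By compactness the map then vanishes somewhere. -/

section Cochains

variable {X : Type*}

/-- The mod 2 coboundary of a cochain on lists. -/
def coboundary : (List X → ZMod 2) → List X → ZMod 2
  | _, [] => 0
  | φ, x :: l => φ l + coboundary (fun l' => φ (x :: l')) l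

/-- The dual of the prism operator between two vertex maps. -/
def prism (f g : X → X) : (List X → ZMod 2) → List X → ZMod 2
  | _, [] => 0
  | φ, x :: l => φ (f x :: g x :: l.map g) + prism f g (fun l' => φ (f x :: l')) l

/-- The cup product of a `0`-cochain with a cochain. -/
def cup (s : X → ZMod 2) (φ : List X → ZMod 2) : List X → ZMod 2
  | [] => 0
  | x :: l => s x * φ (x :: l)

/-- The constant `0`-cochain `1`. -/
def unitCochain : List X → ZMod 2
  | [_] => 1
  | _ => 0

/-- The cup product of the coboundaries of a list of `0`-cochains. -/
def cupCoboundaries : List (X → ZMod 2) → List X → ZMod 2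
  | [] => unitCochain
  | s :: ss => coboundary (cup s (cupCoboundaries ss))

theorem zmod_two_two_eq_zero : (2 : ZMod 2) = 0 := rfl

theorem coboundary_zero (l : List X) : coboundary (fun _ => 0) l = 0 := by
  induction l with
  | nil => rfl
  | cons x l ih => simp [coboundary, ih]

theorem coboundary_add (φ ψ : List X → ZMod 2) (l : List X) :
    coboundary (fun l => φ l + ψ l) l = coboundary φ l + coboundary ψ l := by
  induction l generalizing φ ψ with
  | nil => simp [coboundary]
  | cons x l ih => simp only [coboundary, ih]; ring

theorem coboundary_const_mul (c : ZMod 2) (φ : List X → ZMod 2) (l : List X) :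
    coboundary (fun l => c * φ l) l = c * coboundary φ l := by
  induction l generalizing φ with
  | nil => simp [coboundary]
  | cons x l ih => simp only [coboundary, ih]; ring

theorem coboundary_coboundary (φ : List X → ZMod 2) (l : List X) :
    coboundary (coboundary φ) l = 0 := by
  induction l generalizing φ with
  | nil => rfl
  | cons x l ih =>
    simp only [coboundary, coboundary_add, ih]
    linear_combination coboundary φ l * zmod_two_two_eq_zero

theorem coboundary_map (A : X → X) (φ : List X → ZMod 2) (l : List X) :
    coboundary (fun l => φ (l.map A)) l = coboundary φ (l.map A) := by
  induction l generalizing φ with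
  | nil => rfl
  | cons x l ih =>
    simp only [coboundary, List.map_cons]
    rw [← ih]

theorem prism_add (f g : X → X) (φ ψ : List X → ZMod 2) (l : List X) :
    prism f g (fun l => φ l + ψ l) l = prism f g φ l + prism f g ψ l := by
  induction l generalizing φ ψ with
  | nil => simp [prism]
  | cons x l ih => simp only [prism, ih]; ring

/-- The chain homotopy formula: mod 2, the boundary of a prism is its two ends plus the prism over
the boundary. -/
theorem prism_coboundary (f g : X → X) (φ : List X → ZMod 2) (l : List X) :
    prism f g (coboundary φ) l =
      φ (l.map f) + φ (l.map g) + coboundary (prism f g φ) l := by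
  induction l generalizing φ with
  | nil =>
    simp only [prism, coboundary, List.map_nil]
    linear_combination -φ [] * zmod_two_two_eq_zero
  | cons x l ih =>
    simp only [prism, coboundary, List.map_cons, coboundary_add, prism_add, ih]
    rw [coboundary_map g (fun l' => φ (f x :: g x :: l')) l]
    linear_combination φ (f x :: l.map g) * zmod_two_two_eq_zero

theorem prism_eq_zero (f g : X → X) (φ : List X → ZMod 2) (l : List X)
    (h : ∀ q : List X, (∀ y ∈ q, ∃ x ∈ l, y = f x ∨ y = g x) → φ q = 0) :
    prism f g φ l = 0 := by
  induction l generalizing φ with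
  | nil => rfl
  | cons x l ih =>
    rw [prism, h, ih, add_zero]
    · intro q hq
      apply h
      intro y hy
      rcases List.mem_cons.1 hy with rfl | hy
      · exact ⟨x, by simp, Or.inl rfl⟩
      · obtain ⟨z, hz, hzy⟩ := hq y hy
        exact ⟨z, List.mem_cons_of_mem _ hz, hzy⟩
    · intro y hy
      simp only [List.mem_cons, List.mem_map] at hy
      rcases hy with rfl | rfl | ⟨z, hz, rfl⟩
      · exact ⟨x, by simp, Or.inl rfl⟩
      · exact ⟨x, by simp, Or.inr rfl⟩
      · exact ⟨z, List.mem_cons_of_mem _ hz, Or.inr rfl⟩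

theorem coboundary_unitCochain (l : List X) : coboundary unitCochain l = 0 := by
  match l with
  | [] => rfl
  | [x] => rfl
  | [x, y] => rfl
  | x :: y :: z :: l =>
    simp only [coboundary, unitCochain]
    simp [coboundary_zero]

theorem coboundary_cupCoboundaries (ss : List (X → ZMod 2)) (l : List X) :
    coboundary (cupCoboundaries ss) l = 0 := by
  cases ss with
  | nil => exact coboundary_unitCochain l
  | cons s ss => exact coboundary_coboundary _ l

theorem cupCoboundaries_nil_right (ss : List (X → ZMod 2)) : cupCoboundaries ss [] = 0 := by
  cases ss <;> rfl

/-- Leibniz rule: the remaining factor is a cocycle, so only the coboundary of `s` survives. -/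
theorem cupCoboundaries_cons_cons (s : X → ZMod 2) (ss : List (X → ZMod 2)) (x y : X)
    (l : List X) :
    cupCoboundaries (s :: ss) (x :: y :: l) = (s x + s y) * cupCoboundaries ss (y :: l) := by
  have h := coboundary_cupCoboundaries ss (x :: y :: l)
  rw [coboundary] at h
  rw [cupCoboundaries, coboundary]
  simp only [cup]
  rw [coboundary_const_mul]
  linear_combination s x * h - cupCoboundaries ss (y :: l) * s x * zmod_two_two_eq_zero

theorem exists_ne_of_cupCoboundaries_ne_zero (ss : List (X → ZMod 2)) (l : List X)
    (h : cupCoboundaries ss l ≠ 0) : ∀ s ∈ ss, ∃ x ∈ l, ∃ y ∈ l, s x ≠ s y := by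
  induction ss generalizing l with
  | nil => simp
  | cons s ss ih =>
    match l with
    | [] => exact absurd (cupCoboundaries_nil_right _) h
    | [x] => exact absurd (by simp [cupCoboundaries, coboundary, cup]) h
    | x :: y :: l =>
      rw [cupCoboundaries_cons_cons] at h
      intro t ht
      rcases List.mem_cons.1 ht with rfl | ht
      · refine ⟨x, by simp, y, by simp, fun hxy => left_ne_zero_of_mul h ?_⟩
        rw [hxy]
        exact CharTwo.add_self_eq_zero _
      · obtain ⟨a, ha, b, hb, hab⟩ := ih _ (right_ne_zero_of_mul h) t ht
        exact ⟨a, List.mem_cons_of_mem _ ha, b, List.mem_cons_of_mem _ hb, hab⟩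

theorem cup_map {A : X → X} {s : X → ZMod 2} (hs : ∀ x, s (A x) = s x + 1)
    {φ : List X → ZMod 2} (h0 : φ [] = 0) (hφ : ∀ l, φ (l.map A) = φ l) (l : List X) :
    cup s φ (l.map A) = cup s φ l + φ l := by
  cases l with
  | nil => simp [cup, h0]
  | cons x l =>
    have := hφ (x :: l)
    rw [List.map_cons] at this
    rw [List.map_cons, cup, cup, this, hs]
    ring

/-- Precomposing with `A` changes the cup product with `s` only by a cocycle, which the outer
coboundary kills. -/
theorem cupCoboundaries_map {A : X → X} (ss : List (X → ZMod 2))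
    (hs : ∀ s ∈ ss, ∀ x, s (A x) = s x + 1) (l : List X) :
    cupCoboundaries ss (l.map A) = cupCoboundaries ss l := by
  induction ss generalizing l with
  | nil =>
    match l with
    | [] => rfl
    | [x] => rfl
    | x :: y :: l => rfl
  | cons s ss ih =>
    have ih' := ih fun t ht => hs t (List.mem_cons_of_mem _ ht)
    rw [cupCoboundaries, ← coboundary_map]
    simp only [cup_map (hs s (by simp)) (cupCoboundaries_nil_right ss) ih']
    rw [coboundary_add, coboundary_cupCoboundaries, add_zero]

/-- `E` is a mod 2 chain, given as a functional on cochains and supported on lists satisfying `S`,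
whose sum with its image under `A` is a cycle, and on which the cup product of the coboundaries of
any `k` functions that are antipodal with respect to `A` evaluates to `1`. -/
structure IsHemisphereChain (A : X → X) (k : ℕ) (S : List X → Prop)
    (E : (List X → ZMod 2) → ZMod 2) : Prop where
  add : ∀ φ ψ : List X → ZMod 2, E (fun l => φ l + ψ l) = E φ + E ψ
  supp : ∀ φ : List X → ZMod 2, (∀ l, S l → φ l = 0) → E φ = 0
  cycle : ∀ φ : List X → ZMod 2, E (coboundary φ) + E (fun l => coboundary φ (l.map A)) = 0
  eval : ∀ ss : List (X → ZMod 2), ss.length = k → (∀ s ∈ ss, ∀ x, s (A x) = s x + 1) →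
    E (cupCoboundaries ss) = 1

/-- The complex is augmented by the empty list, so a single point is no cycle, but a pair of points
is one mod 2. -/
theorem isHemisphereChain_point (A : X → X) (S : List X → Prop) (x : X) (hx : S [x]) :
    IsHemisphereChain A 0 S (fun φ => φ [x]) where
  add _ _ := rfl
  supp _ h := h _ hx
  cycle φ := by
    simp only [coboundary, List.map_cons, List.map_nil, add_zero]
    exact CharTwo.add_self_eq_zero _
  eval ss hss _ := by
    rw [List.length_eq_zero_iff.1 hss]
    rfl

theorem IsHemisphereChain.exists_succ {A : X → X} (hA : ∀ x, A (A x) = x) {k : ℕ}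
    {S S' : List X → Prop} {E : (List X → ZMod 2) → ZMod 2} (hE : IsHemisphereChain A k S E)
    (N : ℕ) (h : ℕ → X → X) (h0 : ∀ x, h 0 x = x) {e : X} (hN : ∀ x, h N x = e)
    (hS : ∀ l, S l → S (l.map A))
    (hS' : ∀ l, S l → ∀ j < N, ∀ q : List X,
      (∀ y ∈ q, ∃ x ∈ l, y = h j x ∨ y = h (j + 1) x) → S' q) :
    ∃ E', IsHemisphereChain A (k + 1) S' E' := by
  set z : (List X → ZMod 2) → ZMod 2 := fun φ => E φ + E (fun l => φ (l.map A)) with hz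
  have z_add (φ ψ : List X → ZMod 2) : z (fun l => φ l + ψ l) = z φ + z ψ := by
    simp only [hz, hE.add φ ψ, hE.add (fun l => φ (l.map A)) (fun l => ψ (l.map A))]
    ring
  have z_map (φ : List X → ZMod 2) : z (fun l => φ (l.map A)) = z φ := by
    have hAA : A ∘ A = id := funext hA
    simp only [hz, List.map_map, hAA, List.map_id]
    ring
  have z_cob (φ : List X → ZMod 2) : z (coboundary φ) = 0 := hE.cycle φ
  set E' : (List X → ZMod 2) → ZMod 2 :=
    fun φ => ∑ j ∈ Finset.range N, z (prism (h j) (h (j + 1)) φ) with hE'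
  -- Stokes: the prism sums telescope, leaving the start `z` and the end at the apex, where
  -- antipodal terms cancel.
  have E'_cob (φ : List X → ZMod 2) : E' (coboundary φ) = z φ := by
    have hj (j : ℕ) : z (prism (h j) (h (j + 1)) (coboundary φ)) =
        z (fun l => φ (l.map (h (j + 1)))) - z (fun l => φ (l.map (h j))) := by
      rw [show prism (h j) (h (j + 1)) (coboundary φ) = _ from funext (prism_coboundary _ _ φ),
        z_add (fun l => φ (l.map (h j)) + φ (l.map (h (j + 1)))),
        z_add (fun l => φ (l.map (h j))), z_cob, CharTwo.sub_eq_add]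
      ring
    simp only [hE', hj]
    rw [Finset.sum_range_sub fun j => z (fun l => φ (l.map (h j)))]
    have hid : h 0 = id := funext h0
    have hc : h N ∘ A = h N := funext fun x => by simp [hN]
    have hend : z (fun l => φ (l.map (h N))) = 0 := by
      simp only [hz, List.map_map, hc]
      exact CharTwo.add_self_eq_zero _
    rw [hend, hid]
    simp only [List.map_id, CharTwo.sub_eq_add, zero_add]
  refine ⟨E', ?_, ?_, ?_, ?_⟩
  · intro φ ψ
    simp only [hE', ← Finset.sum_add_distrib]
    refine Finset.sum_congr rfl fun j _ => ?_
    rw [← z_add]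
    exact congrArg z (funext (prism_add _ _ φ ψ))
  · intro φ hφ
    refine Finset.sum_eq_zero fun j hj => ?_
    have hp : ∀ l, S l → prism (h j) (h (j + 1)) φ l = 0 := fun l hl =>
      prism_eq_zero _ _ _ _ fun q hq => hφ q (hS' l hl j (Finset.mem_range.1 hj) q hq)
    simp only [hz]
    rw [hE.supp _ hp, hE.supp _ fun l hl => hp _ (hS l hl), add_zero]
  · intro φ
    have : (fun l => coboundary φ (l.map A)) = coboundary (fun l => φ (l.map A)) :=
      funext fun l => (coboundary_map A φ l).symm
    rw [this, E'_cob, E'_cob, z_map]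
    exact CharTwo.add_self_eq_zero _
  · intro ss hss hanti
    match ss with
    | [] => simp at hss
    | s :: ss =>
      have hanti' : ∀ t ∈ ss, ∀ x, t (A x) = t x + 1 :=
        fun t ht => hanti t (List.mem_cons_of_mem _ ht)
      rw [cupCoboundaries, E'_cob]
      simp only [hz]
      -- On the two halves of `z` the values differ by the shorter cup product on `E`, which is 1 by
      -- hypothesis.
      simp only [cup_map (hanti s (by simp)) (cupCoboundaries_nil_right ss)
        (cupCoboundaries_map ss hanti')]
      rw [hE.add, hE.eval ss (by simpa using hss) hanti', ← add_assoc,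
        CharTwo.add_self_eq_zero, zero_add]

end Cochains

/-! ### Fine chains on the cross-polytope -/

section CrossPolytope

variable {n : ℕ}

/-- The part of the unit `ℓ¹`-sphere on which all coordinates of index greater than `k` vanish. -/
def crossPolytope (n k : ℕ) : Set (Fin n → ℝ) :=
  {x | ∑ i, |x i| = 1 ∧ ∀ i : Fin n, k < i → x i = 0}

/-- A list of marked points of a cross-polytope, with pairwise distances at most `r`. -/
def IsFine (n k : ℕ) (r : ℝ) (l : List ((Fin n → ℝ) × ZMod 2)) : Prop :=
  (∀ x ∈ l, x.1 ∈ crossPolytope n k) ∧ ∀ x ∈ l, ∀ y ∈ l, ‖x.1 - y.1‖ ≤ r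

/-- The antipodal map on marked points. -/
def antipode (x : (Fin n → ℝ) × ZMod 2) : (Fin n → ℝ) × ZMod 2 := (-x.1, x.2 + 1)

theorem antipode_antipode (x : (Fin n → ℝ) × ZMod 2) : antipode (antipode x) = x := by
  ext1
  · simp [antipode]
  · simp only [antipode]
    linear_combination zmod_two_two_eq_zero

theorem neg_mem_crossPolytope {k : ℕ} {x : Fin n → ℝ} (hx : x ∈ crossPolytope n k) :
    -x ∈ crossPolytope n k :=
  ⟨by simpa using hx.1, fun i hi => by simp [hx.2 i hi]⟩

theorem IsFine.map_antipode {k : ℕ} {r : ℝ} {l : List ((Fin n → ℝ) × ZMod 2)}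
    (hl : IsFine n k r l) : IsFine n k r (l.map antipode) := by
  refine ⟨?_, ?_⟩
  · intro x hx
    obtain ⟨y, hy, rfl⟩ := List.mem_map.1 hx
    exact neg_mem_crossPolytope (hl.1 y hy)
  · intro x hx y hy
    obtain ⟨x, hx', rfl⟩ := List.mem_map.1 hx
    obtain ⟨y, hy', rfl⟩ := List.mem_map.1 hy
    have := hl.2 y hy' x hx'
    rwa [show (antipode x).1 - (antipode y).1 = y.1 - x.1 by simp only [antipode]; abel]

theorem norm_le_one_of_mem_crossPolytope {k : ℕ} {x : Fin n → ℝ} (hx : x ∈ crossPolytope n k) :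
    ‖x‖ ≤ 1 := by
  refine (pi_norm_le_iff_of_nonneg zero_le_one).2 fun i => ?_
  rw [Real.norm_eq_abs, ← hx.1]
  exact Finset.single_le_sum (f := fun i => |x i|) (fun j _ => abs_nonneg _) (Finset.mem_univ i)

theorem single_mem_crossPolytope {k : ℕ} (hk : k < n) :
    Pi.single ⟨k, hk⟩ 1 ∈ crossPolytope n k := by
  refine ⟨?_, fun i hi => ?_⟩
  · rw [Finset.sum_eq_single ⟨k, hk⟩] <;> simp +contextual
  · rw [Pi.single_apply, if_neg]
    rintro rfl
    simp at hi

/-- The point and the apex have disjoint supports, so the `ℓ¹`-norm is additive along the segment.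
-/
theorem segment_mem_crossPolytope {k : ℕ} (hk : k + 1 < n) {x : Fin n → ℝ}
    (hx : x ∈ crossPolytope n k) {t : ℝ} (h0 : 0 ≤ t) (h1 : t ≤ 1) :
    (1 - t) • x + t • (Pi.single ⟨k + 1, hk⟩ 1 : Fin n → ℝ) ∈ crossPolytope n (k + 1) := by
  have he := single_mem_crossPolytope hk
  refine ⟨?_, fun i hi => ?_⟩
  · have habs (i : Fin n) : |((1 - t) • x + t • (Pi.single ⟨k + 1, hk⟩ 1 : Fin n → ℝ)) i| =
        (1 - t) * |x i| + t * |(Pi.single ⟨k + 1, hk⟩ 1 : Fin n → ℝ) i| := by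
      simp only [Pi.add_apply, Pi.smul_apply, smul_eq_mul]
      by_cases hi : i = ⟨k + 1, hk⟩
      · have : x i = 0 := hx.2 i (by rw [hi]; simp)
        simp [this, abs_mul, abs_of_nonneg h0]
      · simp [hi, abs_mul, abs_of_nonneg (sub_nonneg.2 h1)]
    simp only [habs, Finset.sum_add_distrib, ← Finset.mul_sum, hx.1, he.1]
    ring
  · simp [hx.2 i (by omega), he.2 i hi]

theorem norm_segment_sub_le {x y e : Fin n → ℝ} {r t u δ : ℝ} (hxy : ‖x - y‖ ≤ r)
    (hy : ‖y‖ ≤ 1) (he : ‖e‖ ≤ 1) (h0 : 0 ≤ t) (h1 : t ≤ 1) (htu : |u - t| ≤ δ) :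
    ‖((1 - t) • x + t • e) - ((1 - u) • y + u • e)‖ ≤ r + 2 * δ := by
  have : ((1 - t) • x + t • e) - ((1 - u) • y + u • e) = (1 - t) • (x - y) + (u - t) • (y - e) := by
    module
  rw [this]
  refine (norm_add_le _ _).trans (add_le_add ?_ ?_)
  · rw [norm_smul, Real.norm_eq_abs, abs_of_nonneg (sub_nonneg.2 h1)]
    nlinarith [norm_nonneg (x - y)]
  · rw [norm_smul, Real.norm_eq_abs]
    have h2 : ‖y - e‖ ≤ 2 := (norm_sub_le _ _).trans (by linarith)
    nlinarith [abs_nonneg (u - t), norm_nonneg (y - e)]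

theorem exists_isHemisphereChain (N : ℕ) (hN : 0 < N) (k : ℕ) (hk : k < n) :
    ∃ E, IsHemisphereChain (antipode (n := n)) k (IsFine n k (k * (2 * (1 / N)))) E := by
  induction k with
  | zero =>
    refine ⟨_, isHemisphereChain_point _ _ (Pi.single ⟨0, hk⟩ 1, 0) ⟨?_, ?_⟩⟩
    · simpa using single_mem_crossPolytope hk
    · simp
  | succ k ih =>
    obtain ⟨E, hE⟩ := ih (by omega)
    have hN' : (0 : ℝ) < N := Nat.cast_pos.2 hN
    set e : Fin n → ℝ := Pi.single ⟨k + 1, hk⟩ 1 with he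
    have he1 : ‖e‖ ≤ 1 := norm_le_one_of_mem_crossPolytope (single_mem_crossPolytope hk)
    -- Resetting the mark at `j = N` makes the last map constant on marked points too.
    set h : ℕ → (Fin n → ℝ) × ZMod 2 → (Fin n → ℝ) × ZMod 2 := fun j x =>
      ((1 - (j / N : ℝ)) • x.1 + (j / N : ℝ) • e, if j = N then 0 else x.2) with hh
    refine hE.exists_succ antipode_antipode N h ?_ (e := (e, 0)) ?_
      (fun l hl => hl.map_antipode) ?_
    · intro x
      simp [hh, hN.ne]
    · intro x
      simp [hh, div_self hN'.ne']
    · intro l hl j hj q hq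
      have key : ∀ y ∈ q, ∃ x ∈ l, ∃ i : ℕ, j ≤ i ∧ i ≤ j + 1 ∧ y = h i x := by
        intro y hy
        obtain ⟨x, hx, rfl | rfl⟩ := hq y hy
        · exact ⟨x, hx, j, le_rfl, by omega, rfl⟩
        · exact ⟨x, hx, j + 1, by omega, le_rfl, rfl⟩
      have h01 (i : ℕ) (hi : i ≤ j + 1) : (0 : ℝ) ≤ i / N ∧ (i / N : ℝ) ≤ 1 :=
        ⟨by positivity, (div_le_one hN').2 (by exact_mod_cast hi.trans hj)⟩
      refine ⟨?_, ?_⟩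
      · intro y hy
        obtain ⟨x, hx, i, -, hi, rfl⟩ := key y hy
        exact segment_mem_crossPolytope hk (hl.1 x hx) (h01 i hi).1 (h01 i hi).2
      · intro y hy y' hy'
        obtain ⟨x, hx, i, hji, hi, rfl⟩ := key y hy
        obtain ⟨x', hx', i', hji', hi', rfl⟩ := key y' hy'
        have hd : |((i' : ℝ) / N) - i / N| ≤ 1 / N := by
          rw [← sub_div, abs_div, abs_of_pos hN']
          refine div_le_div_of_nonneg_right ?_ hN'.le
          have a1 : (j : ℝ) ≤ i := by exact_mod_cast hji
          have a2 : (i : ℝ) ≤ j + 1 := by exact_mod_cast hi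
          have a3 : (j : ℝ) ≤ i' := by exact_mod_cast hji'
          have a4 : (i' : ℝ) ≤ j + 1 := by exact_mod_cast hi'
          exact abs_le.2 ⟨by linarith, by linarith⟩
        have := norm_segment_sub_le (hl.2 x hx x' hx')
          (norm_le_one_of_mem_crossPolytope (hl.1 x' hx')) he1 (h01 i hi).1 (h01 i hi).2 hd
        refine this.trans_eq ?_
        push_cast
        ring

end CrossPolytope

/-! ### The Borsuk–Ulam theorem -/

section BorsukUlam

open Classical in
/-- The sign of `g` at a marked point, where the mark decides at the zeros of `g`. -/
noncomputable def markedSign {n : ℕ} (g : (Fin n → ℝ) → ℝ) (x : (Fin n → ℝ) × ZMod 2) : ZMod 2 :=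
  if 0 < g x.1 then 1 else if g x.1 < 0 then 0 else x.2

/-- The mark keeps this true at zeros of `g`, where no sign of `g` alone could be antipodal. -/
theorem markedSign_antipode {n : ℕ} {g : (Fin n → ℝ) → ℝ} (hg : ∀ x, g (-x) = -g x)
    (x : (Fin n → ℝ) × ZMod 2) : markedSign g (antipode x) = markedSign g x + 1 := by
  simp only [markedSign, antipode, hg]
  rcases lt_trichotomy (g x.1) 0 with h | h | h
  · simp [h, h.not_gt]
  · simp [h]
  · simp only [Left.neg_pos_iff, h.not_gt, if_false, Left.neg_neg_iff, h, if_true]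
    rfl

theorem mul_nonpos_of_markedSign_ne {n : ℕ} {g : (Fin n → ℝ) → ℝ} {x y : (Fin n → ℝ) × ZMod 2}
    (h : markedSign g x ≠ markedSign g y) : g x.1 * g y.1 ≤ 0 := by
  by_contra! hpos
  apply h
  rcases mul_pos_iff.1 hpos with ⟨hx, hy⟩ | ⟨hx, hy⟩
  · simp [markedSign, hx, hy]
  · simp [markedSign, hx, hy, hx.not_gt, hy.not_gt]

theorem isCompact_l1_sphere (n : ℕ) : IsCompact {x : Fin n → ℝ | ∑ i, |x i| = 1} := by
  refine Metric.isCompact_of_isClosed_isBounded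
    (isClosed_eq (by fun_prop) continuous_const) ?_
  refine (Metric.isBounded_closedBall (x := (0 : Fin n → ℝ)) (r := 1)).subset fun x hx => ?_
  rw [mem_closedBall_zero_iff]
  exact norm_le_one_of_mem_crossPolytope (k := n) ⟨hx, fun i hi => absurd i.2 (by omega)⟩

/-- The Borsuk–Ulam theorem on the `ℓ¹`-sphere. -/
theorem exists_forall_eq_zero_of_odd_l1 (m : ℕ) (g : Fin m → (Fin (m + 1) → ℝ) → ℝ)
    (hodd : ∀ i x, g i (-x) = -g i x)
    (hcont : ∀ i, ContinuousOn (g i) {x | ∑ j, |x j| = 1}) :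
    ∃ x : Fin (m + 1) → ℝ, ∑ j, |x j| = 1 ∧ ∀ i, g i x = 0 := by
  set K : Set (Fin (m + 1) → ℝ) := {x | ∑ j, |x j| = 1} with hK
  have hKc : IsCompact K := isCompact_l1_sphere _
  set G : (Fin (m + 1) → ℝ) → (Fin m → ℝ) := fun x i => g i x with hG
  have hGc : ContinuousOn G K := continuousOn_pi.2 hcont
  have hKne : K.Nonempty := ⟨_, (single_mem_crossPolytope (n := m + 1) (k := 0) (by omega)).1⟩
  obtain ⟨x₀, hx₀, hmin⟩ := hKc.exists_isMinOn hKne hGc.norm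
  refine ⟨x₀, hx₀, fun i => ?_⟩
  suffices hz : ‖G x₀‖ = 0 from congrFun (norm_eq_zero.1 hz) i
  by_contra hne
  have hpos : 0 < ‖G x₀‖ := lt_of_le_of_ne (norm_nonneg _) (Ne.symm hne)
  obtain ⟨δ, hδ, hunif⟩ := Metric.uniformContinuousOn_iff.1
    (hKc.uniformContinuousOn_of_continuous hGc) _ hpos
  obtain ⟨N, hN⟩ := exists_nat_gt (m * 2 / δ)
  have hN' : (0 : ℝ) < N := lt_of_le_of_lt (by positivity) hN
  have hsmall : (m : ℝ) * (2 * (1 / N)) < δ := by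
    rw [div_lt_iff₀ hδ] at hN
    rw [show (m : ℝ) * (2 * (1 / N)) = m * 2 / N by ring, div_lt_iff₀ hN']
    linarith
  obtain ⟨E, hE⟩ := exists_isHemisphereChain (n := m + 1) N (Nat.cast_pos.1 hN') m (by omega)
  set ss := List.ofFn fun i => markedSign (g i) with hss
  have heval : E (cupCoboundaries ss) = 1 := by
    refine hE.eval ss (by simp [hss]) fun s hs => ?_
    obtain ⟨i, rfl⟩ := (List.mem_ofFn' _ _).1 hs
    exact markedSign_antipode (hodd i)
  have hex : ∃ l, IsFine (m + 1) m (m * (2 * (1 / N))) l ∧ cupCoboundaries ss l ≠ 0 := by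
    by_contra! hall
    rw [hE.supp _ hall] at heval
    exact zero_ne_one heval
  obtain ⟨l, hl, hne⟩ := hex
  have hdist {x y : (Fin (m + 1) → ℝ) × ZMod 2} (hx : x ∈ l) (hy : y ∈ l) (i : Fin m) :
      |g i x.1 - g i y.1| < ‖G x₀‖ := by
    have := hunif _ (hl.1 x hx).1 _ (hl.1 y hy).1
      (by rw [dist_eq_norm]; exact (hl.2 x hx y hy).trans_lt hsmall)
    rw [dist_eq_norm] at this
    exact (norm_le_pi_norm (G x.1 - G y.1) i).trans_lt this
  match l with
  | [] => exact hne (cupCoboundaries_nil_right _)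
  | a :: l =>
    have hle : ‖G x₀‖ ≤ ‖G a.1‖ := hmin (hl.1 a (by simp)).1
    refine hle.not_gt ?_
    refine (pi_norm_lt_iff hpos).2 fun i => ?_
    obtain ⟨x, hx, y, hy, hxy⟩ := exists_ne_of_cupCoboundaries_ne_zero ss _ hne
      (markedSign (g i)) ((List.mem_ofFn' _ _).2 ⟨i, rfl⟩)
    have hprod := mul_nonpos_of_markedSign_ne hxy
    have h1 := abs_lt.1 (hdist (List.mem_cons_self (a := a)) hx i)
    have h2 := abs_lt.1 (hdist (List.mem_cons_self (a := a)) hy i)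
    -- The values at `x` and `y` have opposite weak signs and both lie within the minimum norm of
    -- the value at `a`.
    change |g i a.1| < _
    rcases mul_nonpos_iff.1 hprod with h | h
    · exact abs_lt.2 ⟨by linarith, by linarith⟩
    · exact abs_lt.2 ⟨by linarith, by linarith⟩

/-- The Borsuk–Ulam theorem: an odd map from the `m`-sphere to a Euclidean space of dimension at
most `m` has a zero. -/
theorem exists_eq_zero_of_odd {m d : ℕ} (hmd : d ≤ m)
    (f : Metric.sphere (0 : EuclideanSpace ℝ (Fin (m + 1))) 1 → EuclideanSpace ℝ (Fin d))
    (hf : Continuous f) (hodd : ∀ p, f (-p) = -f p) : ∃ p, f p = 0 := by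
  classical
  have hne {x : Fin (m + 1) → ℝ} (hx : x ≠ 0) : WithLp.toLp 2 x ≠ 0 := by simpa using hx
  set ν : {x : Fin (m + 1) → ℝ // x ≠ 0} → Metric.sphere (0 : EuclideanSpace ℝ (Fin (m + 1))) 1 :=
    fun x => ⟨‖WithLp.toLp 2 x.1‖⁻¹ • WithLp.toLp 2 x.1, by
      rw [mem_sphere_zero_iff_norm, norm_smul, norm_inv, norm_norm,
        inv_mul_cancel₀ (norm_ne_zero_iff.2 (hne x.2))]⟩ with hν
  have hνc : Continuous ν := by
    have hc : Continuous fun x : {x : Fin (m + 1) → ℝ // x ≠ 0} =>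
        (WithLp.toLp 2 x.1 : EuclideanSpace ℝ (Fin (m + 1))) :=
      (PiLp.continuous_toLp 2 _).comp continuous_subtype_val
    exact ((hc.norm.inv₀ fun x => norm_ne_zero_iff.2 (hne x.2)).smul hc).subtype_mk _
  have hνneg (x : {x : Fin (m + 1) → ℝ // x ≠ 0}) : ν ⟨-x.1, neg_ne_zero.2 x.2⟩ = -ν x := by
    apply Subtype.ext
    simp [hν]
  -- Radial projection transfers `f` to the `ℓ¹`-sphere; zero coordinates pad the target up to
  -- dimension `m`.
  set g : Fin m → (Fin (m + 1) → ℝ) → ℝ := fun i x =>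
    if hx : x ≠ 0 then (if hi : (i : ℕ) < d then f (ν ⟨x, hx⟩) ⟨i, hi⟩ else 0) else 0 with hg
  obtain ⟨x, hx, hzero⟩ := exists_forall_eq_zero_of_odd_l1 m g (fun i x => by
      by_cases hx : x = 0
      · simp [hg, hx]
      · have hx' : -x ≠ 0 := neg_ne_zero.2 hx
        simp only [hg, dif_pos hx, dif_pos hx']
        split_ifs with hi
        · rw [hνneg ⟨x, hx⟩, hodd]
          rfl
        · simp) (fun i => by
      have hsub : {x : Fin (m + 1) → ℝ | ∑ j, |x j| = 1} ⊆ {x | x ≠ 0} := by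
        rintro x hx rfl
        simp at hx
      refine ContinuousOn.mono ?_ hsub
      rw [continuousOn_iff_continuous_domRestrict]
      have hr : Set.domRestrict {x | x ≠ 0} (g i) = fun x : {x : Fin (m + 1) → ℝ // x ≠ 0} =>
          if hi : (i : ℕ) < d then f (ν x) ⟨i, hi⟩ else 0 := by
        funext x
        exact dif_pos x.2
      rw [hr]
      by_cases hi : (i : ℕ) < d
      · simp only [hi, dif_pos]
        fun_prop
      · simp only [hi, dif_neg, not_false_eq_true]
        exact continuous_const)
  have hx0 : x ≠ 0 := by
    rintro rfl
    simp at hx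
  refine ⟨ν ⟨x, hx0⟩, ?_⟩
  ext i
  have := hzero ⟨i, i.2.trans_le hmd⟩
  simpa [hg, hx0] using this

end BorsukUlam

/-! ### A quarter turn of odd-dimensional spheres -/

/-- The coordinate reversal with a sign change in the second half of the coordinates. -/
noncomputable def quarterTurn {n : ℕ} (x : EuclideanSpace ℝ (Fin n)) : EuclideanSpace ℝ (Fin n) :=
  WithLp.toLp 2 fun i => if i < i.rev then x i.rev else -x i.rev

theorem continuous_quarterTurn {n : ℕ} : Continuous (quarterTurn (n := n)) := by
  refine (PiLp.continuous_toLp 2 _).comp (continuous_pi fun i => ?_)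
  split_ifs <;> fun_prop

theorem quarterTurn_neg {n : ℕ} (x : EuclideanSpace ℝ (Fin n)) :
    quarterTurn (-x) = -quarterTurn x := by
  ext i
  simp only [quarterTurn, PiLp.neg_apply]
  split_ifs <;> rfl

theorem norm_quarterTurn {n : ℕ} (x : EuclideanSpace ℝ (Fin n)) : ‖quarterTurn x‖ = ‖x‖ := by
  rw [EuclideanSpace.norm_eq, EuclideanSpace.norm_eq, ← Equiv.sum_comp Fin.revPerm]
  congr 1
  refine Finset.sum_congr rfl fun i _ => ?_
  simp only [quarterTurn, Fin.revPerm_apply, Fin.rev_rev]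
  split_ifs <;> simp

theorem quarterTurn_quarterTurn {n : ℕ} (hn : Even n) (x : EuclideanSpace ℝ (Fin n)) :
    quarterTurn (quarterTurn x) = -x := by
  ext i
  simp only [quarterTurn, PiLp.neg_apply, Fin.rev_rev]
  rcases lt_trichotomy i i.rev with h | h | h
  · simp [h, h.not_gt]
  -- Only a middle index is fixed by reversal, and even `n` has none.
  · exfalso
    have h' := congrArg Fin.val h
    rw [Fin.val_rev] at h'
    obtain ⟨r, hr⟩ := hn
    have := i.2
    omega
  · simp [h, h.not_gt]

theorem mainTheorem2 (m d : ℕ) (hm : Odd m) (hmd : d ≤ m)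
    (f : Metric.sphere (0 : EuclideanSpace ℝ (Fin (m + 1))) 1 → EuclideanSpace ℝ (Fin d))
    (hf : Continuous f) (hodd : ∀ p, f (-p) = -f p) :
    ∃ p₁ p₂ : Metric.sphere (0 : EuclideanSpace ℝ (Fin (m + 1))) 1,
      p₁ ≠ p₂ ∧ p₁ ≠ -p₂ ∧ f p₁ = f p₂ := by
  set J : Metric.sphere (0 : EuclideanSpace ℝ (Fin (m + 1))) 1 →
      Metric.sphere (0 : EuclideanSpace ℝ (Fin (m + 1))) 1 :=
    fun p => ⟨quarterTurn p.1, by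
      rw [mem_sphere_zero_iff_norm, norm_quarterTurn, mem_sphere_zero_iff_norm.1 p.2]⟩ with hJ
  have hJc : Continuous J := (continuous_quarterTurn.comp continuous_subtype_val).subtype_mk _
  have hJneg (p) : J (-p) = -J p := Subtype.ext (quarterTurn_neg p.1)
  have hJJ (p) : J (J p) = -p := Subtype.ext (quarterTurn_quarterTurn hm.add_one p.1)
  have hfree (p : Metric.sphere (0 : EuclideanSpace ℝ (Fin (m + 1))) 1) : p ≠ -p := by
    intro h
    refine ne_zero_of_mem_unit_sphere p ?_
    ext i
    have : p.1 i = -p.1 i := congrArg (fun q => q.1 i) h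
    rw [PiLp.zero_apply]
    linarith
  obtain ⟨p, hp⟩ := exists_eq_zero_of_odd hmd (fun p => f p - f (J p)) (hf.sub (hf.comp hJc))
    (fun p => by simp only [hJneg, hodd]; abel)
  refine ⟨p, J p, fun h => hfree p ?_, fun h => hfree p ?_, sub_eq_zero.1 hp⟩
  · have := hJJ p
    rwa [← h, ← h] at this
  · have := hJJ p
    have hneg : J p = -p := (neg_eq_iff_eq_neg.2 h).symm
    rw [hneg, hJneg, hneg, neg_neg] at this
    exact this
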